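/- Let $G$ be a (possibly infinite) directed graph and let $B\subseteq V(G)$. A path is a finite directed path (possibly a single vertex), and a ray is a one-way infinite directed path $v_0\to v_1\to v_2\to\cdots$ with distinct vertices, starting in $v_0$. A ray $R$ dominates $B$ if $G$ contains infinitely many vertex-disjoint paths from $R$ to $B$. A vertex $v$ dominates $B$ if $G$ contains infinitely many paths from $v$ to $B$ that are vertex-disjoint except in $v$. A path dominates $B$ if its last vertex dominates $B$. Let $\mathcal{L}(G,B)$ be the set of all $I\subseteq V(G)$ for which there is a family of vertex-disjoint paths $(P_a\mid a\in I)$ such that each $P_a$ starts in $a$ and ends in a vertex of $B$. Let $\mathcal{L}_T(G,B)$ be the set of all $I\subseteq V(G)$ that admit a domination linkage to $B$, that is, a family of vertex-disjoint paths or rays $(Q_a\mid a\in I)$ such that each $Q_a$ starts in $a$ and either ends in a vertex of $B$ or dominates $B$. For a set $\mathcal{I}$ of subsets of a set $E$, let $\mathcal{I}^{\mathrm{fin}}$ be the set of all $J\subseteq E$ all of whose finite subsets are in $\mathcal{I}$. Then $\mathcal{L}_T(G,B)=\mathcal{L}(G,B)^{\mathrm{fin}}$. Moreover, $\mathcal{L}_T(G,B)$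 is the set of independent sets of a finitary matroid with ground set $V(G)$, where a matroid (possibly infinite) is finitary if a set is independent whenever all its finite subsets are (equivalently, if all its circuits are finite). -/

import Mathlib

namespace Digraph

variable {V : Type*}

/-- A (finite) directed path in `G`, possibly consisting of a single vertex: a nonempty list of
distinct vertices in which each vertex sends an edge of `G` to the next one. -/
structure DirPath (G : Digraph V) where
  verts : List V
  ne_nil : verts ≠ []
  chain : verts.IsChain G.Adj
  nodup : verts.Nodup

/-- A ray in `G`: a one-way infinite sequence of distinct vertices, directed away from its first
vertex. -/
structure DirRay (G : Digraph V) where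
  vert : ℕ → V
  adj : ∀ n, G.Adj (vert n) (vert (n + 1))
  inj : Function.Injective vert

namespace DirPath

variable {G : Digraph V}

/-- The first vertex of a path. -/
def first (P : G.DirPath) : V := P.verts.head P.ne_nil

/-- The last vertex of a path. -/
def last (P : G.DirPath) : V := P.verts.getLast P.ne_nil

/-- The vertex set of a path. -/
def support (P : G.DirPath) : Set V := {v | v ∈ P.verts}

end DirPath

namespace DirRay

variable {G : Digraph V}

/-- The starting vertex of a ray. -/
def first (R : G.DirRay) : V := R.vert 0

/-- The vertex set of a ray. -/
def support (R : G.DirRay) : Set V := Set.range R.vert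

/-- A ray `R` dominates `B` if `G` contains infinitely many vertex-disjoint directed paths
from `R` to `B`. -/
def Dominates (R : G.DirRay) (B : Set V) : Prop :=
  ∃ S : Set G.DirPath, S.Infinite ∧
    (∀ P ∈ S, P.first ∈ R.support ∧ P.last ∈ B) ∧
    S.Pairwise fun P Q => Disjoint P.support Q.support

end DirRay

/-- A vertex `v` dominates `B` if there are infinitely many directed paths from `v` to `B` that are
vertex-disjoint except in `v`. -/
def VertexDominates (G : Digraph V) (v : V) (B : Set V) : Prop :=
  ∃ S : Set G.DirPath, S.Infinite ∧
    (∀ P ∈ S, P.first = v ∧ P.last ∈ B) ∧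
    S.Pairwise fun P Q => P.support ∩ Q.support ⊆ {v}

/-- A path dominates `B` if its last vertex dominates `B`. -/
def DirPath.Dominates {G : Digraph V} (P : G.DirPath) (B : Set V) : Prop :=
  G.VertexDominates P.last B

/-- A directed path or a ray of `G`. -/
inductive PathOrRay (G : Digraph V) where
  | path (P : G.DirPath) : PathOrRay G
  | ray (R : G.DirRay) : PathOrRay G

namespace PathOrRay

variable {G : Digraph V}

/-- The starting vertex of a path or ray. -/
def first : G.PathOrRay → V
  | path P => P.first
  | ray R => R.first

/-- The vertex set of a path or ray. -/
def support : G.PathOrRay → Set V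
  | path P => P.support
  | ray R => R.support

/-- A path or ray ends in `B` if it is a path whose last vertex is in `B`. -/
def EndsIn (B : Set V) : G.PathOrRay → Prop
  | path P => P.last ∈ B
  | ray _ => False

/-- A path or ray dominates `B`. -/
def Dominates (B : Set V) : G.PathOrRay → Prop
  | path P => P.Dominates B
  | ray R => R.Dominates B

end PathOrRay

/-- `Q` is a linkage from `A` to `B`: a family of vertex-disjoint directed paths `Q a`, `a ∈ A`,
such that `Q a` starts in `a` and ends in `B`. -/
def IsLinkage (G : Digraph V) (A B : Set V) (Q : A → G.DirPath) : Prop :=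
  (∀ a : A, (Q a).first = a ∧ (Q a).last ∈ B) ∧
  Pairwise fun a b => Disjoint (Q a).support (Q b).support

/-- `Q` is a domination linkage from `A` to `B`: a family of vertex-disjoint directed paths or rays
`Q a`, `a ∈ A`, such that `Q a` starts in `a` and either ends in `B` or dominates `B`. -/
def IsDominationLinkage (G : Digraph V) (A B : Set V) (Q : A → G.PathOrRay) : Prop :=
  (∀ a : A, (Q a).first = a ∧ ((Q a).EndsIn B ∨ (Q a).Dominates B)) ∧
  Pairwise fun a b => Disjoint (Q a).support (Q b).support

/-- `L(G,B)`: the vertex sets that can be linked to `B` by vertex-disjoint directed paths. -/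
def gammoid (G : Digraph V) (B : Set V) : Set (Set V) :=
  {I | ∃ Q : I → G.DirPath, G.IsLinkage I B Q}

/-- `L_T(G,B)`: the vertex sets that admit a domination linkage to `B`. -/
def topGammoid (G : Digraph V) (B : Set V) : Set (Set V) :=
  {I | ∃ Q : I → G.PathOrRay, G.IsDominationLinkage I B Q}

end Digraph

/-- The finitarization of a set system: the sets all of whose finite subsets belong to it. -/
def finitarization {E : Type*} (𝓘 : Set (Set E)) : Set (Set E) :=
  {J | ∀ S ⊆ J, S.Finite → S ∈ 𝓘}

/-! Write ∂D for `G.outBoundary B D`. Everything rests on a Hall-type condition, `Feasible` with C =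
R = ∅: |A ∩ D| ≤ |∂D| whenever ∂D is finite. It characterises `G.topGammoid B`
(`mem_topGammoid_iff_feasible`). A violation shows on finitely many elements of A, so the condition
is finitary; for finite A it yields genuine paths by Menger's theorem
(`Feasible.mem_gammoid_of_finite`). This gives the equality. Submodularity of |∂D| makes tight sets
closed under union, whence augmentation of finite sets and the matroid. Necessity: a finite boundary
cannot shut off a dominating vertex or ray, so each track starting in D uses its own vertex of ∂D.
Sufficiency: Zorn's lemma adds tracks one at a time, R being the set of used vertices. Some step
along an edge always preserves feasibility (`Feasible.exists_move`); with compactness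
(`Feasible.exists_finite_core`), a track can be driven out of the interior D \ ∂D of any D with ∂D
finite. Either it reaches a vertex interior to no such set, which lies in B or dominates B, or it
can be continued forever. In the latter case each extension is made to leave the largest
minimum-boundary enclosures of all parts of the track so far, and the limit ray dominates B
(`DirRay.dominates_of_leaves`). -/

namespace Digraph

open Set Filter

variable {V : Type*} {G : Digraph V} {A B C R : Set V}

/-! ### Boundaries and submodularity -/

/-- The vertices of `C` that lie in `B` or send an edge out of `C`. -/
def outBoundary (G : Digraph V) (B C : Set V) : Set V :=
  {v | v ∈ C ∧ (v ∈ B ∨ ∃ w, G.Adj v w ∧ w ∉ C)}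

theorem outBoundary_subset (C : Set V) : G.outBoundary B C ⊆ C := fun _ h => h.1

theorem outBoundary_union_subset (S T : Set V) :
    G.outBoundary B (S ∪ T) ⊆ G.outBoundary B S ∪ G.outBoundary B T := by
  rintro v ⟨hv, h⟩
  rcases hv with hv | hv
  · refine Or.inl ⟨hv, h.imp id ?_⟩
    rintro ⟨w, hw, hwn⟩
    exact ⟨w, hw, fun h => hwn (Or.inl h)⟩
  · refine Or.inr ⟨hv, h.imp id ?_⟩
    rintro ⟨w, hw, hwn⟩
    exact ⟨w, hw, fun h => hwn (Or.inr h)⟩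

theorem outBoundary_inter_subset (S T : Set V) :
    G.outBoundary B (S ∩ T) ⊆ G.outBoundary B S ∪ G.outBoundary B T := by
  rintro v ⟨hv, h | ⟨w, hw, hwn⟩⟩
  · exact Or.inl ⟨hv.1, Or.inl h⟩
  · by_cases hS : w ∈ S
    · exact Or.inr ⟨hv.2, Or.inr ⟨w, hw, fun h => hwn ⟨hS, h⟩⟩⟩
    · exact Or.inl ⟨hv.1, Or.inr ⟨w, hw, hS⟩⟩

theorem outBoundary_union_inter_outBoundary_inter (S T : Set V) :
    G.outBoundary B (S ∪ T) ∩ G.outBoundary B (S ∩ T) ⊆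
      G.outBoundary B S ∩ G.outBoundary B T := by
  rintro v ⟨⟨-, h⟩, ⟨hv, -⟩⟩
  refine ⟨⟨hv.1, h.imp id ?_⟩, ⟨hv.2, h.imp id ?_⟩⟩ <;> rintro ⟨w, hw, hwn⟩
  · exact ⟨w, hw, fun h => hwn (Or.inl h)⟩
  · exact ⟨w, hw, fun h => hwn (Or.inr h)⟩

/-- A vertex in one of the left-hand boundaries is in one of the right-hand ones, and a vertex in
both is in both. -/
theorem encard_outBoundary_submodular (R S T : Set V) :
    (G.outBoundary B (S ∪ T) \ R).encard + (G.outBoundary B (S ∩ T) \ R).encard ≤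
      (G.outBoundary B S \ R).encard + (G.outBoundary B T \ R).encard := by
  rw [← encard_union_add_encard_inter,
    ← encard_union_add_encard_inter (G.outBoundary B S \ R)]
  refine add_le_add (encard_le_encard ?_) (encard_le_encard ?_)
  · rintro v (⟨h, hR⟩ | ⟨h, hR⟩)
    · exact (outBoundary_union_subset S T h).imp (⟨·, hR⟩) (⟨·, hR⟩)
    · exact (outBoundary_inter_subset S T h).imp (⟨·, hR⟩) (⟨·, hR⟩)
  · rintro v ⟨⟨h, hR⟩, ⟨h', -⟩⟩
    have := outBoundary_union_inter_outBoundary_inter S T ⟨h, h'⟩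
    exact ⟨⟨this.1, hR⟩, ⟨this.2, hR⟩⟩

theorem encard_inter_modular (A S T : Set V) :
    (A ∩ (S ∪ T)).encard + (A ∩ (S ∩ T)).encard = (A ∩ S).encard + (A ∩ T).encard := by
  rw [inter_union_distrib_left, inter_inter_distrib_left, encard_union_add_encard_inter]

theorem finite_outBoundary_union {S T : Set V} (hS : (G.outBoundary B S).Finite)
    (hT : (G.outBoundary B T).Finite) : (G.outBoundary B (S ∪ T)).Finite :=
  (hS.union hT).subset (outBoundary_union_subset S T)

/-! ### Feasibility and tight sets -/

/-- No set with boundary finite outside `C` contains more elements of `A` than its boundary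
has vertices outside `R`. -/
def Feasible (G : Digraph V) (B C A R : Set V) : Prop :=
  ∀ D, (G.outBoundary B D \ C).Finite → (A ∩ D).encard ≤ (G.outBoundary B D \ R).encard

/-- `T` attains equality in the condition defining `Digraph.Feasible`. -/
structure Tight (G : Digraph V) (B C A R T : Set V) : Prop where
  finite_diff : (G.outBoundary B T \ C).Finite
  finite_boundary : (G.outBoundary B T \ R).Finite
  le : (G.outBoundary B T \ R).encard ≤ (A ∩ T).encard

theorem Feasible.mono {A' R' C' : Set V} (h : G.Feasible B C A R) (hC : C' ⊆ C) (hA : A' ⊆ A)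
    (hR : R' ⊆ R) : G.Feasible B C' A' R' := fun D hD =>
  (encard_le_encard (inter_subset_inter_left _ hA)).trans
    ((h D (hD.subset (sdiff_subset_sdiff_right hC))).trans
      (encard_le_encard (sdiff_subset_sdiff_right hR)))

theorem Feasible.notMem (h : G.Feasible B C A R) {a : V} (ha : a ∈ A) : a ∉ R := by
  intro haR
  have h1 := h {a} ((finite_singleton a).subset (sdiff_subset.trans (outBoundary_subset _)))
  have h2 : G.outBoundary B {a} \ R = ∅ := by
    refine eq_empty_of_forall_notMem ?_
    rintro v ⟨⟨hv, -⟩, hvR⟩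
    exact hvR (mem_singleton_iff.1 hv ▸ haR)
  have h3 : A ∩ {a} = {a} := by simpa using ha
  rw [h2, h3] at h1
  simp at h1

/-- If a ∈ ∂D, both sides drop by one; otherwise the right side is unchanged. -/
theorem Feasible.remove (h : G.Feasible B C A R) {a : V} (ha : a ∈ A) :
    G.Feasible B C (A \ {a}) (insert a R) := by
  intro D hD
  have haR := h.notMem ha
  by_cases hab : a ∈ G.outBoundary B D
  · have h1 := h D hD
    have e1 : A ∩ D = insert a ((A \ {a}) ∩ D) := by
      ext v; by_cases hv : v = a
      · subst hv; simp [ha, hab.1]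
      · simp [hv]
    have e2 : G.outBoundary B D \ R = insert a (G.outBoundary B D \ insert a R) := by
      ext v; by_cases hv : v = a
      · subst hv; simp [hab, haR]
      · simp [hv]
    rw [e1, e2, encard_insert_of_notMem (by simp), encard_insert_of_notMem (by simp)] at h1
    exact (ENat.add_le_add_iff_right (by simp)).1 h1
  · have e2 : G.outBoundary B D \ insert a R = G.outBoundary B D \ R := by
      ext v; by_cases hv : v = a
      · subst hv; simp [hab]
      · simp [hv]
    rw [e2]
    exact (encard_le_encard (inter_subset_inter_left _ sdiff_subset)).trans (h D hD)

theorem tight_empty : G.Tight B C A R ∅ := by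
  have : G.outBoundary B ∅ = ∅ := subset_empty_iff.1 (outBoundary_subset _)
  constructor <;> simp [this]

/-- |∂D \ R| is submodular and |A ∩ D| modular, so the feasibility inequality at S ∩ T can be
cancelled. -/
theorem Tight.union (h : G.Feasible B C A R) {S T : Set V} (hS : G.Tight B C A R S)
    (hT : G.Tight B C A R T) : G.Tight B C A R (S ∪ T) := by
  have hf : ((G.outBoundary B S ∪ G.outBoundary B T) \ C).Finite := by
    rw [union_sdiff_distrib]; exact hS.finite_diff.union hT.finite_diff
  have hf' : ((G.outBoundary B S ∪ G.outBoundary B T) \ R).Finite := by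
    rw [union_sdiff_distrib]; exact hS.finite_boundary.union hT.finite_boundary
  refine ⟨hf.subset (sdiff_subset_sdiff_left (outBoundary_union_subset S T)),
    hf'.subset (sdiff_subset_sdiff_left (outBoundary_union_subset S T)), ?_⟩
  have hfin : (G.outBoundary B (S ∩ T) \ R).encard ≠ ⊤ :=
    (hf'.subset (sdiff_subset_sdiff_left (outBoundary_inter_subset S T))).encard_lt_top.ne
  have h1 := h (S ∩ T) (hf.subset (sdiff_subset_sdiff_left (outBoundary_inter_subset S T)))
  refine (ENat.add_le_add_iff_right hfin).1 ?_
  calc _ ≤ _ := encard_outBoundary_submodular R S T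
    _ ≤ _ := add_le_add hS.le hT.le
    _ = _ := (encard_inter_modular A S T).symm
    _ ≤ _ := by gcongr

theorem exists_tight_superset (h : G.Feasible B C A R) {N : Set V} (hN : N.Finite)
    (hT : ∀ x ∈ N, ∃ T, x ∈ T ∧ G.Tight B C A R T) : ∃ T, N ⊆ T ∧ G.Tight B C A R T := by
  induction N, hN using Set.Finite.induction_on with
  | empty => exact ⟨∅, Subset.rfl, tight_empty⟩
  | @insert x N _ _ ih =>
    obtain ⟨T, hNT, hT'⟩ := ih fun y hy => hT y (mem_insert_of_mem _ hy)
    obtain ⟨S, hxS, hS⟩ := hT x (mem_insert _ _)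
    exact ⟨S ∪ T, insert_subset (Or.inl hxS) (hNT.trans subset_union_right), hS.union h hT'⟩

/-- A vertex whose addition destroys feasibility lies in a tight set. -/
theorem exists_tight_of_not_feasible_insert (h : G.Feasible B C A R) {x : V}
    (hx : ¬ G.Feasible B C (insert x A) R) : ∃ T, x ∈ T ∧ G.Tight B C A R T := by
  unfold Feasible at hx
  push Not at hx
  obtain ⟨T, hT, hlt⟩ := hx
  have hxT : x ∈ T := by
    by_contra hxT
    rw [insert_inter_of_notMem hxT] at hlt
    exact absurd (h T hT) hlt.not_ge
  refine ⟨T, hxT, hT, encard_lt_top_iff.1 (hlt.trans_le le_top), ?_⟩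
  rw [insert_inter_of_mem hxT] at hlt
  exact Order.le_of_lt_add_one (hlt.trans_le (encard_insert_le _ _))

/-- A feasible set remains feasible after moving one of its elements along a suitable edge. -/
theorem Feasible.exists_move (h : G.Feasible B C A R) {a : V} (ha : a ∈ A) (haB : a ∉ B)
    (hC : ∀ w, G.Adj a w → w ∈ C) (hfin : (C \ R).Finite) :
    ∃ w, G.Adj a w ∧ w ∉ A ∧ w ∉ R ∧ G.Feasible B C (insert w (A \ {a})) (insert a R) := by
  by_contra! hcon
  have h0 := h.remove ha
  have haR := h.notMem ha
  obtain ⟨T, hNT, hT⟩ := exists_tight_superset h0 (N := {w | G.Adj a w ∧ w ∉ insert a R})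
    (hfin.subset fun w hw => ⟨hC w hw.1, fun hR => hw.2 (Or.inr hR)⟩) (by
      rintro w ⟨haw, hwR⟩
      rw [mem_insert_iff, not_or] at hwR
      by_cases hwA : w ∈ A
      · refine ⟨{w}, rfl, ?_, ?_, ?_⟩
        · exact (finite_singleton w).subset (sdiff_subset.trans (outBoundary_subset _))
        · exact (finite_singleton w).subset (sdiff_subset.trans (outBoundary_subset _))
        · rw [inter_eq_self_of_subset_right (by simpa using ⟨hwA, hwR.1⟩)]
          exact encard_le_encard (sdiff_subset.trans (outBoundary_subset _))
      · exact exists_tight_of_not_feasible_insert h0 (hcon w haw hwA hwR.2))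
  -- Adding a and its out-neighbours in R to T makes a interior and creates no boundary outside R,
  -- yet a is one more element of A to be linked.
  set D := T ∪ insert a {w | G.Adj a w ∧ w ∈ R} with hD
  have haD : a ∉ G.outBoundary B D := by
    rintro ⟨-, hB | ⟨w, haw, hwD⟩⟩
    · exact haB hB
    · apply hwD
      by_cases hwa : w = a
      · exact Or.inr (Or.inl hwa)
      · by_cases hwR : w ∈ R
        · exact Or.inr (Or.inr ⟨haw, hwR⟩)
        · exact Or.inl (hNT ⟨haw, by simp [hwa, hwR]⟩)
  have hbd : G.outBoundary B D \ insert a R ⊆ G.outBoundary B T \ insert a R := by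
    rintro v ⟨⟨hvD, hv⟩, hvR⟩
    rw [mem_insert_iff, not_or] at hvR
    have hvT : v ∈ T := by
      rcases hvD with hvT | hva | hvN
      · exact hvT
      · exact absurd hva hvR.1
      · exact absurd hvN.2 hvR.2
    refine ⟨⟨hvT, hv.imp id ?_⟩, by simp [hvR]⟩
    rintro ⟨w, hvw, hwD⟩
    exact ⟨w, hvw, fun hw => hwD (Or.inl hw)⟩
  have hDf : (G.outBoundary B D \ C).Finite := by
    refine (hT.finite_diff.union (finite_singleton a)).subset ?_
    rintro v ⟨⟨hvD, hv⟩, hvC⟩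
    rcases hvD with hvT | hva | hvN
    · refine Or.inl ⟨⟨hvT, hv.imp id ?_⟩, hvC⟩
      rintro ⟨w, hvw, hwD⟩
      exact ⟨w, hvw, fun hw => hwD (Or.inl hw)⟩
    · exact Or.inr hva
    · exact absurd (hC v hvN.1) hvC
  have h1 := h D hDf
  have e1 : A ∩ D = insert a ((A \ {a}) ∩ D) := by
    ext v; by_cases hv : v = a
    · subst hv; simp [ha, hD]
    · simp [hv]
  have e2 : G.outBoundary B D \ R = G.outBoundary B D \ insert a R := by
    ext v; by_cases hv : v = a
    · subst hv; simp [haD]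
    · simp [hv]
  rw [e1, e2, encard_insert_of_notMem (by simp)] at h1
  have h2 : (G.outBoundary B T \ insert a R).encard + 1 ≤ (G.outBoundary B T \ insert a R).encard :=
    calc _ ≤ ((A \ {a}) ∩ T).encard + 1 := add_le_add_left hT.le 1
      _ ≤ ((A \ {a}) ∩ D).encard + 1 := by gcongr; exact subset_union_left
      _ ≤ _ := h1.trans (encard_le_encard hbd)
  exact absurd h2 (not_le.2 (ENat.lt_add_one_iff hT.finite_boundary.encard_lt_top.ne |>.2 le_rfl))

/-! ### Compactness -/

/-- A compactness principle: if deleting all but finitely many vertices of `C` always produces a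
violating subset of `Z`, then `Z` has a violating subset to begin with. -/
theorem exists_violating_subset_of_forall_finite {Z : Set V} (hA : (A ∩ Z).Finite)
    (h : ∀ U : Finset V, ∃ D ⊆ Z,
      (G.outBoundary B D \ (R ∪ (C \ U))).encard < (A ∩ D).encard) :
    ∃ W ⊆ Z, (G.outBoundary B W \ R).encard < (A ∩ W).encard := by
  classical
  choose D hDZ hD using h
  -- Along an ultrafilter finer than `atTop` every vertex is eventually in U, and the sets D U have
  -- a limit W.
  let 𝒰 : Ultrafilter (Finset V) := Ultrafilter.of atTop
  have h𝒰 : (𝒰 : Filter (Finset V)) ≤ atTop := Ultrafilter.of_le _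
  let W : Set V := {v | ∀ᶠ U in 𝒰, v ∈ D U}
  have hW : ∀ v ∉ W, ∀ᶠ U in 𝒰, v ∉ D U := fun v hv => Ultrafilter.eventually_not.2 hv
  have hWZ : W ⊆ Z := fun v hv => by
    obtain ⟨U, hU⟩ := hv.exists
    exact hDZ U hU
  refine ⟨W, hWZ, ?_⟩
  by_contra! hle
  -- For almost all U, the finite set E lies in the boundary of D U outside the deleted vertices,
  -- while A ∩ D U ⊆ W; so D U is not violating.
  obtain ⟨E, hE, hEc⟩ := exists_subset_encard_eq hle
  have hEf : E.Finite := by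
    rw [← encard_lt_top_iff, hEc]
    exact (hA.subset (inter_subset_inter_right _ hWZ)).encard_lt_top
  have h1 : ∀ᶠ U in 𝒰, ∀ v ∈ A ∩ Z, v ∈ D U → v ∈ W := by
    refine (eventually_all_finite hA).2 fun v _ => ?_
    by_cases hv : v ∈ W
    · exact Eventually.of_forall fun _ _ => hv
    · exact (hW v hv).mono fun U hU hU' => absurd hU' hU
  have h2 : ∀ᶠ U in 𝒰, ∀ v ∈ E, v ∈ G.outBoundary B (D U) \ (R ∪ (C \ U)) := by
    refine (eventually_all_finite hEf).2 fun v hv => ?_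
    obtain ⟨⟨hvW, hvB⟩, hvR⟩ := hE hv
    have hvU : ∀ᶠ U : Finset V in 𝒰, v ∈ U :=
      h𝒰 ((eventually_ge_atTop {v}).mono fun U hU => hU (Finset.mem_singleton_self v))
    have hvb : ∀ᶠ U in 𝒰, v ∈ B ∨ ∃ w, G.Adj v w ∧ w ∉ D U := by
      rcases hvB with hvB | ⟨w, hvw, hw⟩
      · exact Eventually.of_forall fun _ => Or.inl hvB
      · exact (hW w hw).mono fun U hU => Or.inr ⟨w, hvw, hU⟩
    filter_upwards [hvW, hvU, hvb] with U hU1 hU2 hU3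
    exact ⟨⟨hU1, hU3⟩, fun hc => hc.elim hvR fun hc => hc.2 hU2⟩
  obtain ⟨U, hU1, hU2⟩ := (h1.and h2).exists
  have h3 : (A ∩ D U).encard ≤ (A ∩ W).encard :=
    encard_le_encard fun v hv => ⟨hv.1, hU1 v ⟨hv.1, hDZ U hv.2⟩ hv.2⟩
  have h4 : E.encard ≤ _ := encard_le_encard hU2
  exact absurd (h4.trans_lt (hD U)) (not_lt.2 (h3.trans hEc.ge))

/-- Within a set `C` of finite boundary, finitely many vertices suffice for feasibility. -/
theorem Feasible.exists_finite_core (h : G.Feasible B ∅ A R)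
    (hR : ∀ D, (G.outBoundary B D).Finite → (R ∩ D).Finite) (hC : (G.outBoundary B C).Finite) :
    ∃ U : Finset V, G.Feasible B C A (R ∪ (C \ U)) := by
  classical
  have hfeas : ∀ D, (G.outBoundary B D).Finite →
      (A ∩ D).Finite ∧ (A ∩ D).ncard ≤ (G.outBoundary B D \ R).ncard := by
    intro D hD
    have h1 := h D (by simpa using hD)
    have hb : (G.outBoundary B D \ R).Finite := hD.subset sdiff_subset
    have ha : (A ∩ D).Finite := encard_lt_top_iff.1 (h1.trans_lt hb.encard_lt_top)
    refine ⟨ha, ?_⟩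
    rw [← hb.cast_ncard_eq, ← ha.cast_ncard_eq] at h1
    exact_mod_cast h1
  -- Z has least slack |∂Z \ R| - |A ∩ Z|. As D ∪ Z has no less, submodularity carries a violation
  -- at D over to D ∩ Z, inside a set where A is finite.
  obtain ⟨Z, ⟨hZf, hCZ⟩, hZmin⟩ := exists_minimalFor_of_wellFoundedLT
    (fun Z : Set V => (G.outBoundary B Z).Finite ∧ C ⊆ Z)
    (fun Z => (G.outBoundary B Z \ R).ncard - (A ∩ Z).ncard) ⟨C, hC, Subset.rfl⟩
  by_contra! hcon
  obtain ⟨W, hWZ, hW⟩ := exists_violating_subset_of_forall_finite (G := G) (B := B) (A := A)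
    (R := R) (C := C) (hfeas Z hZf).1 (by
      intro U
      -- ∂(D ∪ Z) meets C only in ∂C; keeping ∂C in the core ensures that no vertex of ∂(D ∪ Z)
      -- outside R is deleted.
      have hbad := hcon (U ∪ hC.toFinset)
      unfold Feasible at hbad
      push Not at hbad
      obtain ⟨D, hDf, hD⟩ := hbad
      refine ⟨D ∩ Z, inter_subset_right, ?_⟩
      set R' := R ∪ (C \ ↑(U ∪ hC.toFinset)) with hR'
      have hRR' : R ∪ (C \ U) ⊇ R' := by
        refine union_subset_union_right _ (sdiff_subset_sdiff_right ?_)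
        simp
      have hUf : (G.outBoundary B (D ∪ Z)).Finite := by
        refine ((hDf.union hC).union hZf).subset ?_
        rintro v ⟨hv, hv'⟩
        by_cases hvC : v ∈ C
        · refine Or.inl (Or.inr ⟨hvC, hv'.imp id ?_⟩)
          rintro ⟨w, hvw, hw⟩
          exact ⟨w, hvw, fun hwC => hw (Or.inr (hCZ hwC))⟩
        · exact (outBoundary_union_subset D Z ⟨hv, hv'⟩).imp (fun h => Or.inl ⟨h, hvC⟩) id
      have hUeq : G.outBoundary B (D ∪ Z) \ R' = G.outBoundary B (D ∪ Z) \ R := by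
        refine Subset.antisymm (sdiff_subset_sdiff_right subset_union_left) ?_
        rintro v ⟨hv, hvR⟩
        refine ⟨hv, ?_⟩
        rintro (hvR' | ⟨hvC, hvU⟩)
        · exact hvR hvR'
        · apply hvU
          rw [Finset.coe_union]
          refine Or.inr ?_
          rw [Finite.coe_toFinset]
          refine ⟨hvC, hv.2.imp id ?_⟩
          rintro ⟨w, hvw, hw⟩
          exact ⟨w, hvw, fun hwC => hw (Or.inr (hCZ hwC))⟩
      have hsub := encard_outBoundary_submodular (G := G) (B := B) R' D Z
      rw [hUeq] at hsub
      have hmod := encard_inter_modular A D Z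
      obtain ⟨f1, l1⟩ := hfeas _ hUf
      obtain ⟨f2, l2⟩ := hfeas _ hZf
      have f3 : (A ∩ D).Finite := f1.subset (inter_subset_inter_right _ subset_union_left)
      have f4 : (A ∩ (D ∩ Z)).Finite := f2.subset (inter_subset_inter_right _ inter_subset_right)
      have f5 : (G.outBoundary B (D ∪ Z) \ R).Finite := hUf.subset sdiff_subset
      have f6 : (G.outBoundary B Z \ R').Finite := hZf.subset sdiff_subset
      have f7 : (G.outBoundary B D \ R').Finite :=
        encard_lt_top_iff.1 (hD.trans f3.encard_lt_top)
      have f8 : (G.outBoundary B (D ∩ Z) \ R').Finite := by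
        refine (f7.union f6).subset ?_
        rw [← union_sdiff_distrib]
        exact sdiff_subset_sdiff_left (outBoundary_inter_subset D Z)
      have f9 : (G.outBoundary B Z \ R).Finite := hZf.subset sdiff_subset
      have l3 : (G.outBoundary B Z \ R').ncard ≤ (G.outBoundary B Z \ R).ncard :=
        ncard_le_ncard (sdiff_subset_sdiff_right subset_union_left) f9
      have hmin : (G.outBoundary B Z \ R).ncard - (A ∩ Z).ncard ≤
          (G.outBoundary B (D ∪ Z) \ R).ncard - (A ∩ (D ∪ Z)).ncard := by
        rcases le_total ((G.outBoundary B Z \ R).ncard - (A ∩ Z).ncard)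
          ((G.outBoundary B (D ∪ Z) \ R).ncard - (A ∩ (D ∪ Z)).ncard) with hl | hl
        · exact hl
        · exact hZmin ⟨hUf, hCZ.trans subset_union_right⟩ hl
      refine (encard_le_encard (sdiff_subset_sdiff_right hRR')).trans_lt ?_
      rw [← f5.cast_ncard_eq, ← f8.cast_ncard_eq, ← f7.cast_ncard_eq, ← f6.cast_ncard_eq] at hsub
      rw [← f1.cast_ncard_eq, ← f4.cast_ncard_eq, ← f3.cast_ncard_eq, ← f2.cast_ncard_eq] at hmod
      rw [← f7.cast_ncard_eq, ← f3.cast_ncard_eq] at hD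
      rw [← f8.cast_ncard_eq, ← f4.cast_ncard_eq]
      norm_cast at *
      omega)
  have hWf : (G.outBoundary B W).Finite := by
    have h1 : (G.outBoundary B W \ R).Finite :=
      encard_lt_top_iff.1 (hW.trans_le le_top)
    refine (h1.union (hR Z hZf)).subset fun v hv => ?_
    by_cases hvR : v ∈ R
    · exact Or.inr ⟨hvR, hWZ hv.1⟩
    · exact Or.inl ⟨hv, hvR⟩
  exact absurd (h W (by simpa using hWf)) (not_le.2 hW)

/-! ### Path operations and separators -/

namespace DirPath

/-- The path with a single vertex. -/
def single (G : Digraph V) (v : V) : G.DirPath where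
  verts := [v]
  ne_nil := by simp
  chain := by simp
  nodup := by simp

/-- The path obtained by adding a new first vertex. -/
def cons (a : V) (P : G.DirPath) (h : G.Adj a P.first) (ha : a ∉ P.support) : G.DirPath where
  verts := a :: P.verts
  ne_nil := by simp
  chain := by
    obtain ⟨l, hl, hc, hn⟩ := P
    cases l with
    | nil => exact absurd rfl hl
    | cons b l => exact List.isChain_cons_cons.2 ⟨h, hc⟩
  nodup := List.nodup_cons.2 ⟨ha, P.nodup⟩

@[simp] theorem single_last (v : V) : (single G v).last = v := rfl
@[simp] theorem single_support (v : V) : (single G v).support = {v} := by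
  ext; simp [support, single]

theorem first_mem (P : G.DirPath) : P.first ∈ P.support := List.head_mem _
theorem last_mem (P : G.DirPath) : P.last ∈ P.support := List.getLast_mem _
theorem finite_support (P : G.DirPath) : P.support.Finite := List.finite_toSet _

section cons
variable {a : V} {P : G.DirPath} (h : G.Adj a P.first) (ha : a ∉ P.support)

@[simp] theorem cons_first : (cons a P h ha).first = a := rfl
@[simp] theorem cons_last : (cons a P h ha).last = P.last := List.getLast_cons _
@[simp] theorem cons_support : (cons a P h ha).support = insert a P.support := by
  ext; simp [support, cons]

end cons

/-- The final segment of a path starting at one of its vertices. -/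
theorem exists_suffix (P : G.DirPath) {u : V} (hu : u ∈ P.support) :
    ∃ Q : G.DirPath, Q.first = u ∧ Q.last = P.last ∧ Q.support ⊆ P.support := by
  obtain ⟨l, hl, hc, hn⟩ := P
  obtain ⟨s, t, rfl⟩ := List.append_of_mem hu
  refine ⟨⟨u :: t, by simp, (List.isChain_append.1 hc).2.1, (List.nodup_append.1 hn).2.1⟩,
    rfl, ?_, ?_⟩
  · simp [last]
  · intro v hv
    exact List.mem_append_right _ hv

theorem exists_of_adj (P : G.DirPath) {u : V} (h : G.Adj u P.first) :
    ∃ Q : G.DirPath, Q.first = u ∧ Q.last = P.last ∧ Q.support ⊆ insert u P.support := by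
  by_cases hu : u ∈ P.support
  · obtain ⟨Q, h1, h2, h3⟩ := P.exists_suffix hu
    exact ⟨Q, h1, h2, h3.trans (subset_insert _ _)⟩
  · exact ⟨cons u P h hu, rfl, by simp, by simp⟩

/-- The concatenation of two paths sharing only the last vertex of the first one. -/
theorem exists_append (P Q : G.DirPath) (h : Q.first = P.last)
    (hd : P.support ∩ Q.support ⊆ {P.last}) :
    ∃ W : G.DirPath, P.verts <+: W.verts ∧ W.first = P.first ∧ W.last = Q.last ∧
      W.support = P.support ∪ Q.support := by
  obtain ⟨q, hq, hqc, hqn⟩ := Q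
  cases q with
  | nil => exact absurd rfl hq
  | cons t q =>
    have ht : t = P.last := h
    have hPl : P.verts ≠ [] := P.ne_nil
    refine ⟨⟨P.verts ++ q, by simp [hPl], ?_, ?_⟩, List.prefix_append _ _, ?_, ?_, ?_⟩
    · refine List.isChain_append.2 ⟨P.chain, (List.isChain_cons.1 hqc).2, ?_⟩
      intro x hx y hy
      rw [List.getLast?_eq_some_getLast hPl, Option.mem_some_iff] at hx
      have := (List.isChain_cons.1 hqc).1 y hy
      rw [ht] at this
      exact hx ▸ this
    · refine List.nodup_append.2 ⟨P.nodup, (List.nodup_cons.1 hqn).2, ?_⟩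
      rintro x hx _ hy rfl
      have hxt : x = P.last := hd ⟨hx, List.mem_cons_of_mem _ hy⟩
      exact (List.nodup_cons.1 hqn).1 (ht ▸ hxt ▸ hy)
    · simp [first, List.head_append_of_ne_nil hPl]
    · by_cases hq' : q = []
      · subst hq'
        simpa [last] using ht.symm
      · simp [last, List.getLast_append_of_ne_nil _ hq', List.getLast_cons hq']
    · ext x
      simp only [support, mem_ofPred_eq, List.mem_append, List.mem_cons, mem_union]
      refine ⟨fun h => h.imp id Or.inr, ?_⟩
      rintro (h | rfl | h)
      · exact Or.inl h
      · exact Or.inl (ht ▸ P.last_mem)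
      · exact Or.inr h

/-- A path starting in `C` stays in `C` unless it meets the boundary of `C`. -/
theorem meets_outBoundary_or_subset (B : Set V) (P : G.DirPath) (h : P.first ∈ C) :
    (∃ v ∈ P.support, v ∈ G.outBoundary B C) ∨ P.support ⊆ C := by
  obtain ⟨l, hl, hc, hn⟩ := P
  change l.head hl ∈ C at h
  change (∃ v ∈ l, v ∈ G.outBoundary B C) ∨ ∀ v ∈ l, v ∈ C
  clear hn
  induction l with
  | nil => exact absurd rfl hl
  | cons a l ih =>
    cases l with
    | nil => right; simpa using h
    | cons b l =>
      rw [List.isChain_cons_cons] at hc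
      by_cases hb : b ∈ C
      · rcases ih (by simp) hc.2 hb with ⟨v, hv, hv'⟩ | hall
        · exact Or.inl ⟨v, List.mem_cons_of_mem _ hv, hv'⟩
        · right
          intro v hv
          rcases List.mem_cons.1 hv with rfl | hv
          · exact h
          · exact hall v hv
      · exact Or.inl ⟨a, by simp, h, Or.inr ⟨b, hc.1, hb⟩⟩

theorem exists_mem_outBoundary (P : G.DirPath) (h : P.first ∈ C) (hB : P.last ∈ B) :
    ∃ v ∈ P.support, v ∈ G.outBoundary B C := by
  rcases P.meets_outBoundary_or_subset B h with h | h
  · exact h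
  · exact ⟨P.last, P.last_mem, h P.last_mem, Or.inl hB⟩

end DirPath

/-- The vertices all of whose paths to `B` meet `X`. -/
def separated (G : Digraph V) (B X : Set V) : Set V :=
  {u | ∀ P : G.DirPath, P.first = u → P.last ∈ B → ∃ v ∈ P.support, v ∈ X}

/-- If an out-neighbour of u has a path to B avoiding X, then u has a path to B that can meet X only
in u. Thus finite separators give sets of finite boundary. -/
theorem outBoundary_separated_subset (X : Set V) :
    G.outBoundary B (G.separated B X) ⊆ X := by
  rintro u ⟨hu, huB | ⟨w, huw, hw⟩⟩
  · obtain ⟨v, hv, hvX⟩ := hu (DirPath.single G u) rfl huB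
    rw [DirPath.single_support, mem_singleton_iff] at hv
    exact hv ▸ hvX
  · simp only [separated, mem_ofPred_eq, not_forall] at hw
    obtain ⟨P, hPw, hPB, hP⟩ := hw
    obtain ⟨Q, hQu, hQl, hQ⟩ := P.exists_of_adj (hPw ▸ huw)
    obtain ⟨v, hv, hvX⟩ := hu Q hQu (hQl ▸ hPB)
    rcases hQ hv with rfl | hv
    · exact hvX
    · exact absurd ⟨v, hv, hvX⟩ hP

/-! ### Driving tracks out of sets of finite boundary -/

theorem Feasible.exists_path_of_finite (h : G.Feasible B C A R) (hfin : (C \ R).Finite) {a : V}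
    (ha : a ∈ A) : ∃ P : G.DirPath, P.first = a ∧ P.last ∉ C \ G.outBoundary B C ∧
      P.last ∉ A \ {a} ∧ Disjoint P.support R ∧
      G.Feasible B C (insert P.last (A \ {a})) (R ∪ (P.support \ {P.last})) := by
  -- Each move away from an interior vertex a of C puts a into R, so C \ R shrinks.
  induction hn : (C \ R).ncard using Nat.strong_induction_on generalizing A R a with
  | _ n ih =>
  have haR := h.notMem ha
  by_cases haC : a ∈ C \ G.outBoundary B C
  · have haB : a ∉ B := fun hB => haC.2 ⟨haC.1, Or.inl hB⟩
    have hN : ∀ w, G.Adj a w → w ∈ C := fun w hw => by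
      by_contra hwC
      exact haC.2 ⟨haC.1, Or.inr ⟨w, hw, hwC⟩⟩
    obtain ⟨w, haw, hwA, hwR, hw⟩ := h.exists_move ha haB hN hfin
    have hwA' : w ∉ A \ {a} := fun h => hwA h.1
    have hsub : C \ insert a R ⊂ C \ R := by
      refine ⟨sdiff_subset_sdiff_right (subset_insert _ _), fun hs => ?_⟩
      exact (hs ⟨haC.1, haR⟩).2 (mem_insert _ _)
    obtain ⟨P, hPw, hPl, hPA, hPR, hP⟩ := ih _ (hn ▸ ncard_lt_ncard hsub hfin) hw
      (hfin.subset hsub.1) (mem_insert _ _) rfl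
    rw [insert_sdiff_self_of_notMem hwA'] at hPA hP
    have haP : a ∉ P.support := fun haP => disjoint_left.1 hPR haP (mem_insert _ _)
    refine ⟨DirPath.cons a P (hPw ▸ haw) haP, rfl, by simpa using hPl, by simpa using hPA, ?_, ?_⟩
    · rw [DirPath.cons_support]
      refine disjoint_left.2 ?_
      rintro v (rfl | hv) hvR
      · exact haR hvR
      · exact disjoint_left.1 hPR hv (mem_insert_of_mem _ hvR)
    · rw [DirPath.cons_support, DirPath.cons_last]
      refine hP.mono Subset.rfl Subset.rfl ?_
      rintro v (hv | ⟨rfl | hv, hvl⟩)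
      · exact Or.inl (mem_insert_of_mem _ hv)
      · exact Or.inl (mem_insert _ _)
      · exact Or.inr ⟨hv, hvl⟩
  · refine ⟨DirPath.single G a, rfl, haC, by simp, by simpa using haR, ?_⟩
    simpa [insert_eq_of_mem ha] using h

/-- The path `P` avoids `R`, and moving from its first to its last vertex along `P` is
compatible with linking the remaining vertices `A`. -/
structure IsPartialTrack (G : Digraph V) (B A R : Set V) (P : G.DirPath) : Prop where
  last_notMem : P.last ∉ A
  disjoint : Disjoint P.support R
  feasible : G.Feasible B ∅ (insert P.last A) (R ∪ (P.support \ {P.last}))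

theorem IsPartialTrack.feasible_union {P : G.DirPath} (h : G.IsPartialTrack B A R P) :
    G.Feasible B ∅ A (R ∪ P.support) := by
  have := h.feasible.remove (mem_insert _ _)
  rw [insert_sdiff_self_of_notMem h.last_notMem] at this
  refine this.mono Subset.rfl Subset.rfl ?_
  rintro v (hv | hv)
  · exact Or.inr (Or.inl hv)
  · by_cases hvl : v = P.last
    · exact Or.inl hvl
    · exact Or.inr (Or.inr ⟨hv, hvl⟩)

/-- A partial track can be extended so as to leave the interior of any set of finite boundary. -/
theorem IsPartialTrack.exists_extension {P : G.DirPath} (h : G.IsPartialTrack B A R P)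
    (hR : ∀ D, (G.outBoundary B D).Finite → (R ∩ D).Finite)
    (hC : (G.outBoundary B C).Finite) :
    ∃ W : G.DirPath, P.verts <+: W.verts ∧ W.first = P.first ∧ G.IsPartialTrack B A R W ∧
      W.last ∉ C \ G.outBoundary B C := by
  obtain ⟨U, hU⟩ := h.feasible.exists_finite_core (C := C) (by
    intro D hD
    rw [union_inter_distrib_right]
    exact (hR D hD).union (P.finite_support.subset (inter_subset_left.trans sdiff_subset))) hC
  obtain ⟨Q, hQ1, hQ2, hQ3, hQ4, hQ5⟩ := hU.exists_path_of_finite (by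
    refine U.finite_toSet.subset ?_
    rintro v ⟨hvC, hv⟩
    by_contra hvU
    exact hv (Or.inr ⟨hvC, hvU⟩)) (mem_insert _ _)
  rw [insert_sdiff_self_of_notMem h.last_notMem] at hQ3 hQ5
  have hPQ : P.support ∩ Q.support ⊆ {P.last} := by
    rintro v ⟨hvP, hvQ⟩
    by_contra hv
    exact disjoint_left.1 hQ4 hvQ (Or.inl (Or.inr ⟨hvP, hv⟩))
  obtain ⟨W, hW1, hW2, hW3, hW4⟩ := P.exists_append Q hQ1 hPQ
  refine ⟨W, hW1, hW2, ⟨hW3 ▸ hQ3, ?_, ?_⟩, hW3 ▸ hQ2⟩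
  · rw [hW4, disjoint_union_left]
    exact ⟨h.disjoint, hQ4.mono_right (subset_union_left.trans subset_union_left)⟩
  · rw [hW3, hW4]
    refine hQ5.mono (empty_subset _) Subset.rfl ?_
    rintro v (hv | ⟨hv | hv, hvl⟩)
    · exact Or.inl (Or.inl (Or.inl hv))
    · by_cases hvl' : v = P.last
      · exact Or.inr ⟨by rw [hvl', ← hQ1]; exact Q.first_mem, hvl⟩
      · exact Or.inl (Or.inl (Or.inr ⟨hv, hvl'⟩))
    · exact Or.inr ⟨hv, hvl⟩

/-! ### Largest enclosures of minimum boundary -/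

/-- `C` has finite boundary and contains `F` in its interior. -/
def Encloses (G : Digraph V) (B F C : Set V) : Prop :=
  (G.outBoundary B C).Finite ∧ F ⊆ C \ G.outBoundary B C

theorem interior_mono {S T : Set V} (h : S ⊆ T) :
    S \ G.outBoundary B S ⊆ T \ G.outBoundary B T := by
  rintro v ⟨hv, hvb⟩
  refine ⟨h hv, ?_⟩
  rintro ⟨-, hB | ⟨w, hvw, hw⟩⟩
  · exact hvb ⟨hv, Or.inl hB⟩
  · exact hvb ⟨hv, Or.inr ⟨w, hvw, fun hwS => hw (h hwS)⟩⟩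

theorem Encloses.union {F S T : Set V} (hS : G.Encloses B F S) (hT : G.Encloses B F T) :
    G.Encloses B F (S ∪ T) :=
  ⟨finite_outBoundary_union hS.1 hT.1, hS.2.trans (interior_mono subset_union_left)⟩

theorem Encloses.inter {F S T : Set V} (hS : G.Encloses B F S) (hT : G.Encloses B F T) :
    G.Encloses B F (S ∩ T) := by
  refine ⟨(hS.1.union hT.1).subset (outBoundary_inter_subset S T), fun v hv => ?_⟩
  refine ⟨⟨(hS.2 hv).1, (hT.2 hv).1⟩, fun hvb => ?_⟩
  exact (outBoundary_inter_subset S T hvb).elim (hS.2 hv).2 (hT.2 hv).2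

/-- Among the sets enclosing `F` with smallest boundary there is a largest one. -/
theorem exists_greatest_encloses {F : Set V} (h : ∃ C, G.Encloses B F C) :
    ∃ C, G.Encloses B F C ∧
      (∀ D, G.Encloses B F D → (G.outBoundary B C).encard ≤ (G.outBoundary B D).encard) ∧
      ∀ D, G.Encloses B F D → (G.outBoundary B D).encard ≤ (G.outBoundary B C).encard → D ⊆ C := by
  obtain ⟨C₀, hC₀, hmin'⟩ := exists_minimalFor_of_wellFoundedLT (fun C => G.Encloses B F C)
    (fun C => (G.outBoundary B C).encard) h
  have hmin : ∀ D, G.Encloses B F D →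
      (G.outBoundary B C₀).encard ≤ (G.outBoundary B D).encard := fun D hD =>
    (le_total _ _).elim id fun hl => hmin' hD hl
  let M : Set (Set V) := {D | G.Encloses B F D ∧
    (G.outBoundary B D).encard ≤ (G.outBoundary B C₀).encard}
  have hM : ∀ S ∈ M, ∀ T ∈ M, S ∪ T ∈ M := by
    intro S hS T hT
    refine ⟨hS.1.union hT.1, ?_⟩
    have h1 := encard_outBoundary_submodular (G := G) (B := B) ∅ S T
    simp only [sdiff_empty] at h1
    have h2 := hmin _ (hS.1.inter hT.1)
    refine (ENat.add_le_add_iff_right hC₀.1.encard_lt_top.ne).1 ?_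
    calc _ ≤ _ := add_le_add_right h2 _
      _ ≤ _ := h1
      _ ≤ _ := add_le_add hS.2 hT.2
  have hC₀M : C₀ ∈ M := ⟨hC₀, le_rfl⟩
  have hsub : C₀ ⊆ ⋃₀ M := subset_sUnion_of_mem hC₀M
  -- Finitely many boundary vertices of ⋃₀ M lie in a single member of M, and they are boundary
  -- vertices of that smaller set too.
  have hcard : (G.outBoundary B (⋃₀ M)).encard ≤ (G.outBoundary B C₀).encard := by
    by_contra! hlt
    obtain ⟨E, hE, hEc⟩ := exists_subset_encard_eq (Order.add_one_le_of_lt hlt)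
    have hEf : E.Finite := by
      rw [← encard_lt_top_iff, hEc]
      exact ENat.add_lt_top.2 ⟨hC₀.1.encard_lt_top, by simp⟩
    have : ∃ S ∈ M, E ⊆ S := by
      have hEM : E ⊆ ⋃₀ M := hE.trans (outBoundary_subset _)
      clear hE hEc
      induction E, hEf using Set.Finite.induction_on with
      | empty => exact ⟨C₀, hC₀M, empty_subset _⟩
      | @insert x N _ _ ih =>
        obtain ⟨S, hS, hNS⟩ := ih ((subset_insert _ _).trans hEM)
        obtain ⟨T, hT, hxT⟩ := hEM (mem_insert _ _)
        exact ⟨T ∪ S, hM _ hT _ hS, insert_subset (Or.inl hxT) (hNS.trans subset_union_right)⟩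
    obtain ⟨S, hS, hES⟩ := this
    have hEb : E ⊆ G.outBoundary B S := fun v hv => by
      refine ⟨hES hv, (hE hv).2.imp id ?_⟩
      rintro ⟨w, hvw, hw⟩
      exact ⟨w, hvw, fun hwS => hw ⟨S, hS, hwS⟩⟩
    have h1 := (encard_le_encard hEb).trans hS.2
    rw [hEc] at h1
    exact absurd h1 (not_le.2 (ENat.lt_add_one_iff hC₀.1.encard_lt_top.ne |>.2 le_rfl))
  have henc : G.Encloses B F (⋃₀ M) :=
    ⟨encard_lt_top_iff.1 (hcard.trans_lt hC₀.1.encard_lt_top), hC₀.2.trans (interior_mono hsub)⟩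
  exact ⟨⋃₀ M, henc, fun D hD => hcard.trans (hmin D hD),
    fun D hD hle => subset_sUnion_of_mem ⟨hD, hle.trans hcard⟩⟩

/-! ### Domination and finite boundaries -/

theorem vertexDominates_of_forall {v : V} (hvB : v ∉ B)
    (h : ∀ C, (G.outBoundary B C).Finite → v ∈ C → v ∈ G.outBoundary B C) :
    G.VertexDominates v B := by
  -- Otherwise v ∈ `G.separated B X`, whose boundary lies in the finite set X, so v itself would be
  -- in X.
  have hpath : ∀ X : Set V, X.Finite → v ∉ X →
      ∃ P : G.DirPath, (P.first = v ∧ P.last ∈ B) ∧ Disjoint P.support X := by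
    intro X hX hvX
    by_contra! hcon
    refine hvX (outBoundary_separated_subset X (h _ (hX.subset (outBoundary_separated_subset X)) ?_))
    intro P hP hPB
    exact not_disjoint_iff.1 (hcon P ⟨hP, hPB⟩)
  obtain ⟨f, hf, hf'⟩ := exists_seq_of_forall_finset_exists
    (fun P : G.DirPath => P.first = v ∧ P.last ∈ B) (fun P Q => P.support ∩ Q.support ⊆ {v}) (by
      intro s _
      obtain ⟨P, hP, hPd⟩ := hpath ((⋃ Q ∈ s, Q.support) \ {v})
        ((s.finite_toSet.biUnion fun Q _ => Q.finite_support).subset sdiff_subset) (by simp)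
      refine ⟨P, hP, fun Q hQ u hu => ?_⟩
      by_contra huv
      exact disjoint_left.1 hPd hu.2 ⟨mem_biUnion hQ hu.1, huv⟩)
  have hd : ∀ m n, m ≠ n → (f m).support ∩ (f n).support ⊆ {v} := by
    intro m n hmn
    rcases hmn.lt_or_gt with hl | hl
    · exact hf' m n hl
    · rw [inter_comm]; exact hf' n m hl
  refine ⟨range f, infinite_range_of_injective fun m n hmn => ?_, ?_, ?_⟩
  · by_contra hne
    have h1 := hd m n hne ⟨(f m).last_mem, hmn ▸ (f m).last_mem⟩
    exact hvB (mem_singleton_iff.1 h1 ▸ (hf m).2)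
  · rintro _ ⟨n, rfl⟩
    exact hf n
  · rintro _ ⟨m, rfl⟩ _ ⟨n, rfl⟩ hne
    exact hd m n fun h => hne (h ▸ rfl)

theorem DirRay.dominates_of_forall (R : G.DirRay)
    (h : ∀ X : Set V, X.Finite → ¬ R.support ⊆ G.separated B X) : R.Dominates B := by
  obtain ⟨f, hf, hf'⟩ := exists_seq_of_forall_finset_exists
    (fun P : G.DirPath => P.first ∈ R.support ∧ P.last ∈ B)
    (fun P Q => Disjoint P.support Q.support) (by
      intro s _
      have hs := h (⋃ Q ∈ s, Q.support) (s.finite_toSet.biUnion fun Q _ => Q.finite_support)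
      obtain ⟨v, hvR, hv⟩ := not_subset.1 hs
      simp only [separated, mem_ofPred_eq, not_forall] at hv
      obtain ⟨P, hP, hPB, hPX⟩ := hv
      refine ⟨P, ⟨hP ▸ hvR, hPB⟩, fun Q hQ => disjoint_left.2 fun u huQ huP => ?_⟩
      exact hPX ⟨u, huP, mem_biUnion hQ huQ⟩)
  have hd : ∀ m n, m ≠ n → Disjoint (f m).support (f n).support := by
    intro m n hmn
    rcases hmn.lt_or_gt with hl | hl
    · exact hf' m n hl
    · exact (hf' n m hl).symm
  refine ⟨range f, infinite_range_of_injective fun m n hmn => ?_, ?_, ?_⟩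
  · by_contra hne
    exact disjoint_left.1 (hd m n hne) (f m).last_mem (hmn ▸ (f m).last_mem)
  · rintro _ ⟨n, rfl⟩
    exact hf n
  · rintro _ ⟨m, rfl⟩ _ ⟨n, rfl⟩ hne
    exact hd m n fun h => hne (h ▸ rfl)

/-- Otherwise infinitely many paths sharing only v would leave through distinct vertices of the
finite set ∂C. -/
theorem VertexDominates.mem_outBoundary {v : V} (h : G.VertexDominates v B)
    (hC : (G.outBoundary B C).Finite) (hv : v ∈ C) : v ∈ G.outBoundary B C := by
  by_contra hvb
  obtain ⟨S, hS, hSB, hSd⟩ := h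
  have hmeet : ∀ P ∈ S, ∃ u ∈ P.support, u ∈ G.outBoundary B C := fun P hP =>
    P.exists_mem_outBoundary ((hSB P hP).1 ▸ hv) (hSB P hP).2
  have : Nonempty V := ⟨v⟩
  choose! f hfP hfb using hmeet
  refine hS (Finite.of_injOn (f := f) (t := G.outBoundary B C) hfb ?_ hC)
  intro P hP Q hQ hPQ
  by_contra hne
  have : f P = v := hSd hP hQ hne ⟨hfP P hP, hPQ ▸ hfP Q hQ⟩
  exact hvb (this ▸ hfb P hP)

/-- If the tail stayed in C, the disjoint paths starting on it would use distinct vertices of ∂C;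
only finitely many others can start on the first N vertices. -/
theorem DirRay.Dominates.exists_notMem {R : G.DirRay} (h : R.Dominates B)
    (hC : (G.outBoundary B C).Finite) (N : ℕ) : ∃ n ≥ N, R.vert n ∉ C := by
  by_contra! hcon
  obtain ⟨S, hS, hSB, hSd⟩ := h
  have hmeet : ∀ P ∈ S, P.first ∈ C → ∃ u ∈ P.support, u ∈ G.outBoundary B C := fun P hP hPC =>
    P.exists_mem_outBoundary hPC (hSB P hP).2
  have : Nonempty V := ⟨R.vert 0⟩
  choose! f hfP hfb using hmeet
  have h1 : {P ∈ S | P.first ∈ C}.Finite := by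
    refine Finite.of_injOn (f := f) (t := G.outBoundary B C) (fun P hP => hfb P hP.1 hP.2) ?_ hC
    intro P hP Q hQ hPQ
    by_contra hne
    exact disjoint_left.1 (hSd hP.1 hQ.1 hne) (hfP P hP.1 hP.2) (hPQ ▸ hfP Q hQ.1 hQ.2)
  have h2 : {P ∈ S | P.first ∈ R.vert '' Iio N}.Finite := by
    refine Finite.of_injOn (f := DirPath.first) (t := R.vert '' Iio N) (fun P hP => hP.2) ?_
      ((finite_Iio N).image _)
    intro P hP Q hQ hPQ
    by_contra hne
    exact disjoint_left.1 (hSd hP.1 hQ.1 hne) P.first_mem (hPQ ▸ Q.first_mem)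
  refine hS ((h1.union h2).subset fun P hP => ?_)
  obtain ⟨n, hn⟩ := (hSB P hP).1
  rcases le_or_gt N n with hNn | hNn
  · exact Or.inl ⟨hP, hn ▸ hcon n hNn⟩
  · exact Or.inr ⟨hP, n, hNn, hn⟩

theorem DirRay.Dominates.exists_mem_outBoundary {R : G.DirRay} (h : R.Dominates B)
    (hC : (G.outBoundary B C).Finite) {n : ℕ} (hn : R.vert n ∈ C) :
    ∃ m ≥ n, R.vert m ∈ G.outBoundary B C := by
  by_contra! hcon
  have hall : ∀ m ≥ n, R.vert m ∈ C := by
    intro m hm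
    induction m, hm using Nat.le_induction with
    | base => exact hn
    | succ m hm ih =>
      by_contra hmC
      exact hcon m hm ⟨ih, Or.inr ⟨_, R.adj m, hmC⟩⟩
  obtain ⟨m, hm, hmC⟩ := h.exists_notMem hC n
  exact hmC (hall m hm)

theorem PathOrRay.exists_mem_outBoundary {Q : G.PathOrRay} (hQ : Q.EndsIn B ∨ Q.Dominates B)
    (hC : (G.outBoundary B C).Finite) {v : V} (hv : v ∈ Q.support) (hvC : v ∈ C) :
    ∃ u ∈ Q.support, u ∈ G.outBoundary B C := by
  cases Q with
  | path P =>
    obtain ⟨W, hW1, hW2, hW3⟩ := P.exists_suffix hv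
    rcases W.meets_outBoundary_or_subset B (C := C) (hW1 ▸ hvC) with ⟨u, hu, hub⟩ | hW
    · exact ⟨u, hW3 hu, hub⟩
    · have hPC : P.last ∈ C := hW2 ▸ hW W.last_mem
      refine ⟨P.last, P.last_mem, ?_⟩
      rcases hQ with hQ | hQ
      · exact ⟨hPC, Or.inl hQ⟩
      · exact VertexDominates.mem_outBoundary hQ hC hPC
  | ray R =>
    have hR : R.Dominates B := hQ.resolve_left id
    obtain ⟨n, rfl⟩ := hv
    obtain ⟨m, -, hm⟩ := hR.exists_mem_outBoundary hC hvC
    exact ⟨_, ⟨m, rfl⟩, hm⟩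

theorem PathOrRay.finite_support_inter {Q : G.PathOrRay} (hQ : Q.EndsIn B ∨ Q.Dominates B)
    (hC : (G.outBoundary B C).Finite) : (Q.support ∩ C).Finite := by
  cases Q with
  | path P => exact P.finite_support.subset inter_subset_left
  | ray R =>
    have hR : R.Dominates B := hQ.resolve_left id
    have h1 : {n | R.vert n ∈ C}.Finite := by
      by_contra hinf
      have h2 : {n | R.vert n ∈ G.outBoundary B C}.Infinite := by
        refine infinite_of_not_bddAbove ?_
        rintro ⟨N, hN⟩
        obtain ⟨n, hn, hNn⟩ := Set.Infinite.exists_gt hinf N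
        obtain ⟨m, hm, hmb⟩ := hR.exists_mem_outBoundary hC hn
        exact absurd (hN hmb) (not_le.2 (hNn.trans_le hm))
      exact h2 (hC.preimage R.inj.injOn)
    refine (h1.image R.vert).subset ?_
    rintro _ ⟨⟨n, rfl⟩, hn⟩
    exact ⟨n, hn, rfl⟩

/-! ### Limit rays and the construction of a track -/

/-- A strictly increasing sequence of paths converges to a ray. -/
theorem exists_ray_of_prefix (P : ℕ → G.DirPath) (hP : ∀ n, (P n).verts <+: (P (n + 1)).verts)
    (hl : ∀ n, (P n).verts.length < (P (n + 1)).verts.length) :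
    ∃ R : G.DirRay, R.first = (P 0).first ∧
      (∀ n, ∃ p ≥ n, (P n).last = R.vert p ∧ (P n).support = R.vert '' Iic p) := by
  have hlen : ∀ n, n < (P n).verts.length := by
    intro n
    induction n with
    | zero => exact List.length_pos_iff.2 (P 0).ne_nil
    | succ n ih => exact (Nat.succ_le_of_lt ih).trans_lt (hl n)
  have hpre : ∀ m n, m ≤ n → (P m).verts <+: (P n).verts := by
    intro m n hmn
    induction n, hmn using Nat.le_induction with
    | base => exact List.prefix_rfl
    | succ n _ ih => exact ih.trans (hP n)
  let r : ℕ → V := fun n => (P n).verts[n]'(hlen n)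
  have hr : ∀ m n (h : n < (P m).verts.length), (P m).verts[n] = r n := by
    intro m n h
    rcases le_total m n with hmn | hmn
    · exact (hpre m n hmn).getElem h
    · exact ((hpre n m hmn).getElem (hlen n)).symm
  refine ⟨⟨r, fun n => ?_, fun m n hmn => ?_⟩, ?_, fun n => ?_⟩
  · have h1 := hlen (n + 1)
    have h2 := List.isChain_iff_getElem.1 (P (n + 1)).chain n h1
    rwa [hr _ _ (Nat.lt_of_succ_lt h1), hr _ _ h1] at h2
  · have h1 := hlen (max m n)
    have hm := (le_max_left m n).trans_lt h1
    have hn := (le_max_right m n).trans_lt h1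
    rw [← hr _ _ hm, ← hr _ _ hn] at hmn
    exact ((P (max m n)).nodup.getElem_inj_iff).1 hmn
  · exact (List.head_eq_getElem (P 0).ne_nil).symm
  · refine ⟨(P n).verts.length - 1, Nat.le_sub_one_of_lt (hlen n), ?_, ?_⟩
    · exact (List.getLast_eq_getElem _).trans (hr _ _ _)
    · ext v
      constructor
      · intro hv
        obtain ⟨i, hi, rfl⟩ := List.mem_iff_getElem.1 hv
        exact ⟨i, Nat.le_sub_one_of_lt hi, (hr _ _ hi).symm⟩
      · rintro ⟨i, hi, rfl⟩
        have hi' : i < (P n).verts.length :=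
          Nat.lt_of_le_sub_one ((Nat.zero_le _).trans_lt (hlen n)) hi
        change r i ∈ (P n).verts
        rw [← hr n i hi']
        exact List.getElem_mem hi'

theorem finite_outBoundary_biUnion {ι : Type*} {s : Set ι} (hs : s.Finite) {K : ι → Set V}
    (hK : ∀ i ∈ s, (G.outBoundary B (K i)).Finite) :
    (G.outBoundary B (⋃ i ∈ s, K i)).Finite := by
  refine (hs.biUnion hK).subset ?_
  rintro v ⟨hv, hvb⟩
  obtain ⟨i, hi, hvi⟩ := mem_iUnion₂.1 hv
  refine mem_biUnion hi ⟨hvi, hvb.imp id ?_⟩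
  rintro ⟨w, hvw, hw⟩
  exact ⟨w, hvw, fun hwi => hw (mem_biUnion hi hwi)⟩

/-- A ray which keeps leaving the largest tightest enclosures of its finite parts dominates `B`. -/
theorem DirRay.dominates_of_leaves (R : G.DirRay) {K : Set V → Set V}
    (hK : ∀ F, (∃ C, G.Encloses B F C) → G.Encloses B F (K F) ∧
      (∀ D, G.Encloses B F D → (G.outBoundary B (K F)).encard ≤ (G.outBoundary B D).encard) ∧
      ∀ D, G.Encloses B F D →
        (G.outBoundary B D).encard ≤ (G.outBoundary B (K F)).encard → D ⊆ K F)
    (hR : ∀ n, ∃ p ≥ n, ∀ F ⊆ R.vert '' Iic n, R.vert p ∉ K F \ G.outBoundary B (K F)) :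
    R.Dominates B := by
  refine R.dominates_of_forall fun X hX hsub => ?_
  set C := G.separated B X
  have hCX : G.outBoundary B C ⊆ X := outBoundary_separated_subset X
  have hCf : (G.outBoundary B C).Finite := hX.subset hCX
  obtain ⟨n₀, hn₀⟩ : ∃ n₀, ∀ n ≥ n₀, R.vert n ∉ X := by
    obtain ⟨N, hN⟩ := (hX.preimage R.inj.injOn).bddAbove
    exact ⟨N + 1, fun n hn hX => absurd (hN hX) (not_le.2 hn)⟩
  -- Starting at n₀ discards the vertices of the ray in X, so that C encloses every F m.
  let F : ℕ → Set V := fun m => R.vert '' Icc n₀ m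
  have hF : ∀ m, G.Encloses B (F m) C := by
    refine fun m => ⟨hCf, ?_⟩
    rintro _ ⟨n, hn, rfl⟩
    exact ⟨hsub ⟨n, rfl⟩, fun hb => hn₀ n hn.1 (hCX hb)⟩
  have hKF := fun m => hK (F m) ⟨C, hF m⟩
  -- The sizes |∂(K (F m))| are bounded by |∂C|; m₁ attains their maximum.
  obtain ⟨m₁, -, hm₁⟩ := exists_minimalFor_of_wellFoundedLT (fun _ : ℕ => True)
    (fun m => (G.outBoundary B C).encard - (G.outBoundary B (K (F m))).encard) ⟨0, trivial⟩
  have hmax : ∀ m, (G.outBoundary B (K (F m))).encard ≤ (G.outBoundary B (K (F m₁))).encard := by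
    intro m
    have hm := (hKF m).2.1 C (hF m)
    have hm' := (hKF m₁).2.1 C (hF m₁)
    rw [← hCf.cast_ncard_eq, ← (hKF m).1.1.cast_ncard_eq] at hm
    rw [← hCf.cast_ncard_eq, ← (hKF m₁).1.1.cast_ncard_eq] at hm'
    have h1 := hm₁ (j := m) trivial
    simp only [← hCf.cast_ncard_eq, ← (hKF m).1.1.cast_ncard_eq,
      ← (hKF m₁).1.1.cast_ncard_eq] at h1 ⊢
    norm_cast at *
    omega
  -- By the choice of m₁, enclosures of longer segments are also minimum enclosures of F m₁, hence
  -- contained in the largest one. It traps the whole tail in its interior.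
  have hin : ∀ n ≥ n₀, R.vert n ∈ K (F m₁) \ G.outBoundary B (K (F m₁)) := by
    intro n hn
    have henc : G.Encloses B (F m₁) (K (F (max n m₁))) := by
      refine ⟨(hKF _).1.1, Subset.trans ?_ (hKF _).1.2⟩
      exact image_mono (Icc_subset_Icc_right (le_max_right _ _))
    have hsub := (hKF m₁).2.2 _ henc (hmax _)
    exact interior_mono hsub ((hKF (max n m₁)).1.2 ⟨n, ⟨hn, le_max_left _ _⟩, rfl⟩)
  obtain ⟨p, hp, hpF⟩ := hR (max n₀ m₁)
  refine hpF (F m₁) (image_mono fun i hi => ?_) (hin p ((le_max_left _ _).trans hp))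
  exact hi.2.trans (le_max_right _ _)

/-- Any vertex of a feasible set is the start of a path or ray that ends in or dominates `B` and
whose deletion keeps the remaining vertices feasible. -/
theorem Feasible.exists_track (h : G.Feasible B ∅ A R)
    (hR : ∀ D, (G.outBoundary B D).Finite → (R ∩ D).Finite) {a : V} (ha : a ∈ A) :
    ∃ Q : G.PathOrRay, Q.first = a ∧ (Q.EndsIn B ∨ Q.Dominates B) ∧ Disjoint Q.support R ∧
      G.Feasible B ∅ (A \ {a}) (R ∪ Q.support) := by
  classical
  by_cases hex : ∃ P : G.DirPath, P.first = a ∧ G.IsPartialTrack B (A \ {a}) R P ∧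
      ∀ C, (G.outBoundary B C).Finite → P.last ∈ C → P.last ∈ G.outBoundary B C
  · obtain ⟨P, hPa, hP, hPl⟩ := hex
    refine ⟨.path P, hPa, ?_, hP.disjoint, hP.feasible_union⟩
    by_cases hB : P.last ∈ B
    · exact Or.inl hB
    · exact Or.inr (vertexDominates_of_forall hB hPl)
  · push Not at hex
    have hK : ∀ F, ∃ K, (G.outBoundary B K).Finite ∧
        ((∃ C, G.Encloses B F C) → G.Encloses B F K ∧
        (∀ D, G.Encloses B F D → (G.outBoundary B K).encard ≤ (G.outBoundary B D).encard) ∧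
        ∀ D, G.Encloses B F D →
          (G.outBoundary B D).encard ≤ (G.outBoundary B K).encard → D ⊆ K) := by
      intro F
      by_cases hF : ∃ C, G.Encloses B F C
      · obtain ⟨K, hK⟩ := exists_greatest_encloses hF
        exact ⟨K, hK.1.1, fun _ => hK⟩
      -- Sets F without an enclosure get the dummy value ∅, so that K F always has finite boundary.
      · exact ⟨∅, finite_empty.subset (outBoundary_subset _), fun h => absurd h hF⟩
    choose K hKf hK using hK
    let α := {P : G.DirPath // P.first = a ∧ G.IsPartialTrack B (A \ {a}) R P}
    have hnext : ∀ P : α, ∃ W : α, P.1.verts <+: W.1.verts ∧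
        P.1.verts.length < W.1.verts.length ∧
        ∀ F ⊆ P.1.support, W.1.last ∉ K F \ G.outBoundary B (K F) := by
      rintro ⟨P, hPa, hP⟩
      obtain ⟨C, hCf, hPC, hPC'⟩ := hex P hPa hP
      -- P has finitely many vertex subsets F, so all the K F can be left at once; leaving also C,
      -- to which `P.last` is interior, forces a proper extension.
      have hTf := finite_outBoundary_biUnion (P.finite_support.finite_subsets) (B := B) (G := G)
        (K := K) fun F _ => hKf F
      obtain ⟨W, hPW, hWa, hW, hWl⟩ := hP.exists_extension hR (finite_outBoundary_union hCf hTf)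
      refine ⟨⟨W, hWa.trans hPa, hW⟩, hPW, lt_of_le_of_ne hPW.length_le fun hlen => ?_,
        fun F hF hWF => hWl ?_⟩
      · have hPW' : P.verts = W.verts := hPW.eq_of_length hlen
        have hlast : W.last = P.last := by simp [DirPath.last, hPW']
        rw [hlast] at hWl
        exact hWl (interior_mono subset_union_left ⟨hPC, hPC'⟩)
      · refine interior_mono (Subset.trans ?_ subset_union_right) hWF
        exact subset_biUnion_of_mem (u := K) (show F ∈ {F | F ⊆ P.support} from hF)
    choose next hn1 hn2 hn3 using hnext
    let P₀ : α := ⟨DirPath.single G a, rfl, by simp, by simpa using h.notMem ha, by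
      simpa [insert_eq_of_mem ha] using h⟩
    let P : ℕ → α := fun n => next^[n] P₀
    have hPs : ∀ n, P (n + 1) = next (P n) := fun n => Function.iterate_succ_apply' next n P₀
    obtain ⟨Q, hQ1, hQ2⟩ := exists_ray_of_prefix (fun n => (P n).1)
      (fun n => by rw [hPs]; exact hn1 _) (fun n => by rw [hPs]; exact hn2 _)
    refine ⟨.ray Q, hQ1, Or.inr ?_, ?_, ?_⟩
    · refine Q.dominates_of_leaves hK fun n => ?_
      obtain ⟨q, hq, -, hqs⟩ := hQ2 n
      obtain ⟨p, hp, hpl, -⟩ := hQ2 (n + 1)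
      refine ⟨p, (Nat.le_succ n).trans hp, fun F hF => ?_⟩
      rw [← hpl, hPs]
      refine hn3 _ F (hF.trans ?_)
      rw [hqs]
      exact image_mono (Iic_subset_Iic.2 hq)
    · refine disjoint_left.2 ?_
      rintro _ ⟨n, rfl⟩ hnR
      obtain ⟨q, hq, -, hqs⟩ := hQ2 n
      exact disjoint_left.1 (P n).2.2.disjoint (hqs ▸ ⟨n, hq, rfl⟩) hnR
    · intro D hD
      have hDf : (G.outBoundary B D).Finite := by simpa using hD
      -- The ray meets ∂D only finitely often, so the feasibility known for a long enough initial
      -- path suffices.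
      obtain ⟨N, hN⟩ := (hDf.preimage Q.inj.injOn).bddAbove
      obtain ⟨q, hq, -, hqs⟩ := hQ2 N
      refine ((P N).2.2.feasible_union D hD).trans (encard_le_encard ?_)
      rintro v ⟨hv, hvR⟩
      refine ⟨hv, ?_⟩
      rintro (hvR' | ⟨n, rfl⟩)
      · exact hvR (Or.inl hvR')
      · exact hvR (Or.inr (hqs ▸ ⟨n, (hN hv).trans hq, rfl⟩))

/-! ### Feasible sets are those with a domination linkage -/

theorem PathOrRay.first_mem : ∀ Q : G.PathOrRay, Q.first ∈ Q.support
  | .path P => P.first_mem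
  | .ray _ => ⟨0, rfl⟩

/-- Disjoint tracks meeting D use distinct vertices of ∂D, so there are finitely many, each with
finitely many vertices in D. This provides the hypothesis on R in `Feasible.exists_track`. -/
theorem finite_biUnion_support_inter {𝒬 : Set G.PathOrRay}
    (h : ∀ Q ∈ 𝒬, Q.EndsIn B ∨ Q.Dominates B) (hd : 𝒬.PairwiseDisjoint PathOrRay.support)
    {D : Set V} (hD : (G.outBoundary B D).Finite) :
    ((⋃ Q ∈ 𝒬, Q.support) ∩ D).Finite := by
  have hmeet : ∀ Q : G.PathOrRay, Q ∈ 𝒬 → (Q.support ∩ D).Nonempty →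
      ∃ u ∈ Q.support, u ∈ G.outBoundary B D := fun Q hQ ⟨v, hv, hvD⟩ =>
    Q.exists_mem_outBoundary (h Q hQ) hD hv hvD
  rcases isEmpty_or_nonempty V with hV | hV
  · exact toFinite _
  choose! f hfQ hfb using hmeet
  have hfin : {Q ∈ 𝒬 | (Q.support ∩ D).Nonempty}.Finite := by
    refine Finite.of_injOn (f := f) (t := G.outBoundary B D) (fun Q hQ => hfb Q hQ.1 hQ.2) ?_ hD
    intro P hP Q hQ hPQ
    by_contra hne
    exact disjoint_left.1 (hd hP.1 hQ.1 hne) (hfQ P hP.1 hP.2) (hPQ ▸ hfQ Q hQ.1 hQ.2)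
  refine (hfin.biUnion fun Q hQ => Q.finite_support_inter (h Q hQ.1) hD).subset ?_
  rintro v ⟨hv, hvD⟩
  obtain ⟨Q, hQ, hvQ⟩ := mem_iUnion₂.1 hv
  exact mem_biUnion (show Q ∈ {Q ∈ 𝒬 | (Q.support ∩ D).Nonempty} from ⟨hQ, v, hvQ, hvD⟩)
    ⟨hvQ, hvD⟩

theorem Feasible.mem_topGammoid (h : G.Feasible B ∅ A ∅) : A ∈ G.topGammoid B := by
  let S : Set (Set G.PathOrRay) := {𝒬 | (∀ Q ∈ 𝒬, Q.EndsIn B ∨ Q.Dominates B) ∧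
    𝒬.PairwiseDisjoint PathOrRay.support ∧
    G.Feasible B ∅ (A \ PathOrRay.first '' 𝒬) (⋃ Q ∈ 𝒬, Q.support)}
  obtain ⟨𝒬, -, h𝒬⟩ := zorn_subset_nonempty S (by
    intro c hcS hc hne
    refine ⟨⋃₀ c, ⟨?_, ?_, ?_⟩, fun _ => subset_sUnion_of_mem⟩
    · rintro Q ⟨𝒲, h𝒲, hQ⟩
      exact (hcS h𝒲).1 Q hQ
    · exact (pairwiseDisjoint_sUnion hc.directedOn).2 fun 𝒲 h𝒲 => (hcS h𝒲).2.1
    · intro D hD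
      have hDf : (G.outBoundary B D).Finite := by simpa using hD
      -- Only the finitely many used vertices in ∂D matter, and a single member of the chain already
      -- covers them.
      have hE : ∀ E : Set V, E.Finite → E ⊆ ⋃ Q ∈ ⋃₀ c, Q.support →
          ∃ 𝒲 ∈ c, E ⊆ ⋃ Q ∈ 𝒲, Q.support := by
        intro E hE hEc
        induction E, hE using Set.Finite.induction_on with
        | empty => exact ⟨hne.some, hne.some_mem, empty_subset _⟩
        | @insert x N _ _ ih =>
          obtain ⟨𝒲, h𝒲, hN⟩ := ih ((subset_insert _ _).trans hEc)
          obtain ⟨Q, ⟨𝒲', h𝒲', hQ⟩, hxQ⟩ := mem_iUnion₂.1 (hEc (mem_insert _ _))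
          obtain ⟨𝒲'', h𝒲'', h1, h2⟩ := hc.directedOn 𝒲 h𝒲 𝒲' h𝒲'
          exact ⟨𝒲'', h𝒲'', insert_subset (mem_biUnion (h2 hQ) hxQ)
            (hN.trans (biUnion_subset_biUnion_left h1))⟩
      obtain ⟨𝒲, h𝒲, hsub⟩ := hE (G.outBoundary B D ∩ ⋃ Q ∈ ⋃₀ c, Q.support)
        (hDf.subset inter_subset_left) inter_subset_right
      refine (encard_le_encard (inter_subset_inter_left _ (sdiff_subset_sdiff_right
        (image_mono (subset_sUnion_of_mem h𝒲))))).trans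
        (((hcS h𝒲).2.2 D hD).trans (encard_le_encard ?_))
      rintro v ⟨hv, hvR⟩
      exact ⟨hv, fun hvc => hvR (hsub ⟨hv, hvc⟩)⟩) ∅ ⟨by simp, by simp, by simpa using h⟩
  obtain ⟨h1, h2, h3⟩ := h𝒬.prop
  have hall : ∀ a ∈ A, ∃ Q ∈ 𝒬, Q.first = a := by
    by_contra! hcon
    obtain ⟨a, ha, haQ⟩ := hcon
    obtain ⟨Q, hQa, hQB, hQd, hQ⟩ := h3.exists_track
      (fun D hD => finite_biUnion_support_inter h1 h2 hD) (a := a)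
      ⟨ha, fun ⟨Q, hQ, hQa⟩ => haQ Q hQ hQa⟩
    have hS : insert Q 𝒬 ∈ S := by
      refine ⟨forall_mem_insert.2 ⟨hQB, h1⟩, h2.insert fun P hP _ => ?_, ?_⟩
      · exact hQd.mono_right (subset_biUnion_of_mem (u := PathOrRay.support) hP)
      · refine hQ.mono Subset.rfl ?_ ?_
        · rintro v ⟨hvA, hv⟩
          rw [image_insert_eq, mem_insert_iff, not_or, hQa] at hv
          exact ⟨⟨hvA, hv.2⟩, hv.1⟩
        · rw [biUnion_insert, union_comm]
    exact haQ Q (h𝒬.le_of_ge hS (subset_insert _ _) (mem_insert _ _)) hQa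
  choose Q hQ hQa using hall
  refine ⟨fun a => Q a a.2, fun a => ⟨hQa a a.2, h1 _ (hQ a a.2)⟩, fun a b hab => ?_⟩
  refine h2 (hQ a a.2) (hQ b b.2) fun heq => hab (Subtype.ext ?_)
  rw [← hQa a a.2, heq, hQa b b.2]

theorem feasible_of_mem_topGammoid (h : A ∈ G.topGammoid B) : G.Feasible B ∅ A ∅ := by
  obtain ⟨Q, hQ, hQd⟩ := h
  intro D hD
  rw [sdiff_empty] at hD ⊢
  have hmeet : ∀ a, ∃ u, ∀ ha : a ∈ A, a ∈ D → u ∈ (Q ⟨a, ha⟩).support ∧ u ∈ G.outBoundary B D := by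
    intro a
    by_cases ha : a ∈ A ∩ D
    · have hfirst : a ∈ (Q ⟨a, ha.1⟩).support := by
        simpa only [(hQ ⟨a, ha.1⟩).1] using (Q ⟨a, ha.1⟩).first_mem
      obtain ⟨u, hu, hub⟩ := PathOrRay.exists_mem_outBoundary (hQ ⟨a, ha.1⟩).2 hD hfirst ha.2
      exact ⟨u, fun _ _ => ⟨hu, hub⟩⟩
    · exact ⟨a, fun h1 h2 => absurd ⟨h1, h2⟩ ha⟩
  choose f hf using hmeet
  refine encard_le_encard_of_injOn (f := f) (fun a ha => (hf a ha.1 ha.2).2) ?_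
  intro a ha b hb hab
  by_contra hne
  exact disjoint_left.1 (hQd (i := ⟨a, ha.1⟩) (j := ⟨b, hb.1⟩) fun h => hne (congrArg Subtype.val h))
    (hf a ha.1 ha.2).1 (hab ▸ (hf b hb.1 hb.2).1)

theorem mem_topGammoid_iff_feasible : A ∈ G.topGammoid B ↔ G.Feasible B ∅ A ∅ :=
  ⟨feasible_of_mem_topGammoid, Feasible.mem_topGammoid⟩

theorem gammoid_subset_topGammoid : G.gammoid B ⊆ G.topGammoid B := by
  rintro A ⟨Q, hQ, hQd⟩
  exact ⟨fun a => .path (Q a), fun a => ⟨(hQ a).1, Or.inl (hQ a).2⟩, hQd⟩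

/-! ### Finite sets, Menger's theorem and the matroid -/

theorem feasible_of_forall_finite
    (h : ∀ F ⊆ A, F.Finite → G.Feasible B C F R) : G.Feasible B C A R := by
  intro D hD
  by_contra! hlt
  -- At a violation |∂D \ R| is finite, and one element of A more than that suffices to exhibit it.
  obtain ⟨E, hE, hEc⟩ := exists_subset_encard_eq (Order.add_one_le_of_lt hlt)
  have hfin : (G.outBoundary B D \ R).encard < ⊤ := hlt.trans_le le_top
  have hEf : E.Finite := by
    rw [← encard_lt_top_iff, hEc]
    exact ENat.add_lt_top.2 ⟨hfin, by simp⟩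
  have h1 := h E (hE.trans inter_subset_left) hEf D hD
  rw [inter_eq_self_of_subset_left (hE.trans inter_subset_right), hEc] at h1
  exact absurd h1 (not_le.2 ((ENat.lt_add_one_iff hfin.ne).2 le_rfl))

/-- Menger's theorem, inside a finite vertex set `U`. -/
theorem Feasible.exists_linkage {U : Finset V} (h : G.Feasible B univ A (U : Set V)ᶜ) :
    ∃ Q : V → G.DirPath, (∀ a ∈ A, (Q a).first = a ∧ (Q a).last ∈ B ∧ (Q a).support ⊆ U) ∧
      A.PairwiseDisjoint fun a => (Q a).support := by
  classical
  induction hn : U.card generalizing U A with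
  | zero =>
    have hA : A = ∅ := eq_empty_of_forall_notMem fun a ha => h.notMem ha (by
      simp [Finset.card_eq_zero.1 hn])
    exact ⟨DirPath.single G, by simp [hA]⟩
  | succ n ih =>
    have hAU : A ⊆ U := fun a ha => by simpa using h.notMem ha
    by_cases hAB : A ⊆ B
    · refine ⟨DirPath.single G, fun a ha => ⟨rfl, hAB ha, by simpa using hAU ha⟩, ?_⟩
      intro a _ b _ hab
      simpa [Function.onFun] using hab
    · obtain ⟨a, ha, haB⟩ := not_subset.1 hAB
      -- Replace a by w, delete a from U, and prepend a to the path obtained from w.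
      obtain ⟨w, haw, hwA, -, hw⟩ := h.exists_move ha haB (fun _ _ => mem_univ _)
        (U.finite_toSet.subset fun v hv => by simpa using hv.2)
      have hcompl : insert a (U : Set V)ᶜ = (↑(U.erase a) : Set V)ᶜ := by
        ext v; by_cases hv : v = a <;> simp [hv]
      rw [hcompl] at hw
      obtain ⟨Q, hQ, hQd⟩ := ih hw (by rw [Finset.card_erase_of_mem (hAU ha), hn]; rfl)
      obtain ⟨hw1, hw2, hw3⟩ := hQ w (mem_insert _ _)
      have hsub : (↑(U.erase a) : Set V) ⊆ U := by simp
      have haE : ∀ x ∈ insert w (A \ {a}), a ∉ (Q x).support := fun x hx hax => by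
        simpa using (hQ x hx).2.2 hax
      have haw' : G.Adj a (Q w).first := hw1.symm ▸ haw
      have haQ : a ∉ (Q w).support := haE w (mem_insert _ _)
      have hmem : ∀ x ∈ A, x ≠ a → x ∈ insert w (A \ {a}) := fun x hx hxa => Or.inr ⟨hx, hxa⟩
      have hdisj : ∀ x ∈ A, x ≠ a → Disjoint (insert a (Q w).support) (Q x).support := by
        intro x hx hxa
        rw [disjoint_insert_left]
        exact ⟨haE x (hmem x hx hxa), hQd (mem_insert _ _) (hmem x hx hxa) fun h => hwA (h ▸ hx)⟩
      refine ⟨Function.update Q a (DirPath.cons a (Q w) haw' haQ), fun x hx => ?_, ?_⟩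
      · by_cases hxa : x = a
        · subst hxa
          simp only [Function.update_self, DirPath.cons_first, DirPath.cons_last,
            DirPath.cons_support, true_and]
          exact ⟨hw2, insert_subset (hAU ha) (hw3.trans hsub)⟩
        · rw [Function.update_of_ne hxa]
          obtain ⟨h1, h2, h3⟩ := hQ x (hmem x hx hxa)
          exact ⟨h1, h2, h3.trans hsub⟩
      · intro x hx y hy hxy
        change Disjoint (DirPath.support _) (DirPath.support _)
        by_cases hxa : x = a
        · have hya : y ≠ a := fun h => hxy (hxa.trans h.symm)
          subst hxa
          rw [Function.update_self, Function.update_of_ne hya, DirPath.cons_support]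
          exact hdisj y hy hya
        · by_cases hya : y = a
          · subst hya
            rw [Function.update_self, Function.update_of_ne hxa, DirPath.cons_support]
            exact (hdisj x hx hxa).symm
          · rw [Function.update_of_ne hxa, Function.update_of_ne hya]
            exact hQd (hmem x hx hxa) (hmem y hy hya) hxy

/-- Menger's theorem for a finite set in a possibly infinite digraph. -/
theorem Feasible.mem_gammoid_of_finite (h : G.Feasible B ∅ A ∅) (hA : A.Finite) :
    A ∈ G.gammoid B := by
  -- Compactness with C = Z = `univ`, possible since A is finite, confines the problem to a finite
  -- vertex set.
  have hcore : ∃ U : Finset V, G.Feasible B univ A (U : Set V)ᶜ := by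
    by_contra! hcon
    obtain ⟨W, -, hW⟩ := exists_violating_subset_of_forall_finite (G := G) (B := B) (A := A)
      (R := ∅) (C := univ) (Z := univ) (hA.subset inter_subset_left) (by
        intro U
        have hbad := hcon U
        unfold Feasible at hbad
        push Not at hbad
        obtain ⟨D, -, hD⟩ := hbad
        refine ⟨D, subset_univ _, ?_⟩
        rwa [empty_union, ← compl_eq_univ_sdiff])
    have hWf : (G.outBoundary B W \ ∅).Finite := encard_lt_top_iff.1 (hW.trans_le le_top)
    exact absurd (h W hWf) (not_le.2 hW)
  obtain ⟨U, hU⟩ := hcore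
  obtain ⟨Q, hQ, hQd⟩ := hU.exists_linkage
  refine ⟨fun a => Q a, fun a => ⟨(hQ a a.2).1, (hQ a a.2).2.1⟩, fun a b hab => ?_⟩
  exact hQd a.2 b.2 fun h => hab (Subtype.ext h)

theorem topGammoid_eq_finitarization (G : Digraph V) (B : Set V) :
    G.topGammoid B = finitarization (G.gammoid B) := by
  ext A
  rw [mem_topGammoid_iff_feasible]
  refine ⟨fun h F hF hFf => ?_, fun h => feasible_of_forall_finite fun F hF hFf => ?_⟩
  · exact (h.mono Subset.rfl hF Subset.rfl).mem_gammoid_of_finite hFf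
  · exact feasible_of_mem_topGammoid (gammoid_subset_topGammoid (h F hF hFf))

/-- If no e works, one set T tight for I covers J \ I. Then |J ∩ T| ≤ |∂T| ≤ |I ∩ T| and J \ T ⊆ I \
T, so |J| ≤ |I|. -/
theorem Feasible.exists_insert {I J : Set V} (hI : G.Feasible B ∅ I ∅) (hIf : I.Finite)
    (hJ : G.Feasible B ∅ J ∅) (hJf : J.Finite) (hlt : I.ncard < J.ncard) :
    ∃ e ∈ J, e ∉ I ∧ G.Feasible B ∅ (insert e I) ∅ := by
  by_contra! hcon
  obtain ⟨T, hJT, hT⟩ := exists_tight_superset hI (hJf.subset (sdiff_subset (s := J) (t := I)))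
    fun e he => exists_tight_of_not_feasible_insert hI (hcon e he.1 he.2)
  have h1 : (J ∩ T).encard ≤ (I ∩ T).encard := (hJ T hT.finite_diff).trans hT.le
  have h2 : (J \ T).encard ≤ (I \ T).encard := encard_le_encard fun v hv => by
    refine ⟨?_, hv.2⟩
    by_contra hvI
    exact hv.2 (hJT ⟨hv.1, hvI⟩)
  have h3 : J.encard ≤ I.encard := by
    rw [← encard_sdiff_add_encard_inter J T, ← encard_sdiff_add_encard_inter I T]
    exact add_le_add h2 h1
  rw [← hIf.cast_ncard_eq, ← hJf.cast_ncard_eq] at h3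
  exact absurd (by exact_mod_cast h3) (not_le.2 hlt)

/-- The finitary matroid of the sets with a domination linkage to `B`. -/
def topGammoidMatroid (G : Digraph V) (B : Set V) : IndepMatroid V :=
  IndepMatroid.ofFinitaryCardAugment univ (fun I => G.Feasible B ∅ I ∅)
    (fun D _ => by simp)
    (fun _ _ hJ hIJ => hJ.mono Subset.rfl hIJ Subset.rfl)
    (fun _ _ hI hIf hJ hJf hlt => hI.exists_insert hIf hJ hJf hlt)
    (fun _ h => feasible_of_forall_finite h)
    (fun _ _ => subset_univ _)

end Digraph

theorem corollary5p7 {V : Type*} (G : Digraph V) (B : Set V) :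
    G.topGammoid B = finitarization (G.gammoid B) ∧
    ∃ M : Matroid V, M.E = Set.univ ∧ M.Finitary ∧ {I : Set V | M.Indep I} = G.topGammoid B := by
  refine ⟨G.topGammoid_eq_finitarization B, (G.topGammoidMatroid B).matroid, rfl,
    ⟨fun I hI => Digraph.feasible_of_forall_finite hI⟩, ?_⟩
  ext I
  exact Digraph.mem_topGammoid_iff_feasible.symm
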